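/- Let $\mathcal G=(\mathbb V,\mathbb E)$ be a connected metric graph with at most countably many edges, such that every vertex has finite degree and the edge lengths $\ell_e\in(0,+\infty]$ satisfy $\inf_{e\in\mathbb E}\ell_e>0$. Loops and multiple edges are allowed; an edge of infinite length is a half-line, attached to the graph at its endpoint. Let $Z$ be a (possibly empty or infinite) set of vertices of degree $1$, not containing any of the vertices at infinity of the half-lines, and let $p>2$. Put $H^1_Z(\mathcal G)=\{u\in H^1(\mathcal G): u(v)=0 \text{ for all } v\in Z\}$, where $H^1(\mathcal G)$ is the space of continuous functions $u:\mathcal G\to\mathbb R$ which are locally absolutely continuous on every edge and satisfy $u,u'\in L^2(\mathcal G)$, and let $$\omega_Z(\mathcal G)=\inf_{v\in H^1_Z(\mathcal G)\setminus\{0\}}\frac{\|v'\|_{L^2(\mathcal G)}^2}{\|v\|_{L^2(\mathcal G)}^2}.$$ For $\lambda>-\omega_Z(\mathcal G)$ define, for $u\in H^1_Z(\mathcal G)$, $$J_\lambda(u)=\tfrac12\|u'\|_{L^2(\mathcal G)}^2+\tfrac\lambda2\|u\|_{L^2(\mathcal G)}^2-\tfrac1p\|u\|_{L^p(\mathcal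 G)}^p,$$ $$\mathcal N_{\lambda,Z}(\mathcal G)=\{u\in H^1_Z(\mathcal G): u\neq0,\ \|u'\|_{L^2(\mathcal G)}^2+\lambda\|u\|_{L^2(\mathcal G)}^2=\|u\|_{L^p(\mathcal G)}^p\},$$ $$\mathcal M_{\lambda,Z}(\mathcal G)=\{u\in H^1_Z(\mathcal G): u^+,u^-\in\mathcal N_{\lambda,Z}(\mathcal G)\},\qquad u^+=\max(u,0),\quad u^-=\min(u,0).$$ Let $u\in\mathcal M_{\lambda,Z}(\mathcal G)$ be a nodal ground state, i.e. $J_\lambda(u)=\inf_{v\in\mathcal M_{\lambda,Z}(\mathcal G)}J_\lambda(v)$. Then $u$ has exactly two nodal domains: $\mathcal G\setminus u^{-1}(0)$ has exactly two connected components. -/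

import Mathlib

open MeasureTheory Set
open scoped ENNReal

noncomputable section

/-- A metric graph with vertex set `V` (the vertices at infinity are not listed in `V`) and edge
set `E`. Loops and multiple edges are allowed. An edge `e` of finite length is a copy of the
interval `[0, len e]`, whose endpoint `0` is the vertex `src e` and whose endpoint `len e` is the
vertex `tgt e`. An edge of infinite length is a half-line `[0, ∞)`, whose endpoint `0` is the vertex
`src e`; its other end is at infinity, which is recorded by `tgt e = none`. -/
structure MetricGraph (V : Type*) (E : Type*) where
  len : E → ℝ≥0∞
  len_pos : ∀ e, 0 < len e
  src : E → V
  tgt : E → Option V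
  tgt_eq_none_iff : ∀ e, tgt e = none ↔ len e = ⊤

namespace MetricGraph

variable {V : Type*} {E : Type*} (G : MetricGraph V E)

/-- The interval `[0, len e]`, resp. `[0, ∞)`, parametrizing the edge `e`. -/
def edge (e : E) : Set ℝ := {x | 0 ≤ x ∧ ENNReal.ofReal x ≤ G.len e}

theorem zero_mem_edge (e : E) : (0 : ℝ) ∈ G.edge e := by simp [edge]

/-- The disjoint union of the vertices and of the closed edges. -/
def Pieces (G : MetricGraph V E) : Type _ := V ⊕ (Σ e : E, G.edge e)

/-- The disjoint union topology, where the set of vertices is discrete. -/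
instance : TopologicalSpace G.Pieces :=
  letI : TopologicalSpace V := ⊥
  inferInstanceAs (TopologicalSpace (V ⊕ (Σ e : E, G.edge e)))

/-- Each endpoint of an edge is glued to the corresponding vertex. -/
inductive Glue : G.Pieces → G.Pieces → Prop
  | src (e : E) : Glue (Sum.inr ⟨e, ⟨0, G.zero_mem_edge e⟩⟩) (Sum.inl (G.src e))
  | tgt (e : E) (x : G.edge e) (v : V) (hx : ENNReal.ofReal (x : ℝ) = G.len e)
      (hv : G.tgt e = some v) : Glue (Sum.inr ⟨e, x⟩) (Sum.inl v)

/-- The metric graph as a topological space. For locally finite graphs whose edge lengths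
are bounded away from zero, the quotient topology is the topology of the path metric. -/
def Space (G : MetricGraph V E) : Type _ := Quot G.Glue

instance : TopologicalSpace G.Space := inferInstanceAs (TopologicalSpace (Quot G.Glue))

/-- The point of the graph given by a vertex. -/
def vertex (v : V) : G.Space := Quot.mk _ (Sum.inl v)

/-- The point of coordinate `x` on the edge `e`. -/
def point (e : E) (x : G.edge e) : G.Space := Quot.mk _ (Sum.inr ⟨e, x⟩)

/-- The number of edge ends at `v`, so that a loop counts twice. -/
def degree (v : V) : ℕ∞ := {e | G.src e = v}.encard + {e | G.tgt e = some v}.encard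

/-- The class of connected, locally finite metric graphs with at most countably many edges,
whose lengths are bounded away from zero. -/
structure IsAdmissible : Prop where
  connected : ConnectedSpace G.Space
  countable : Countable E
  degree_lt_top : ∀ v, G.degree v < ⊤
  iInf_len_pos : 0 < ⨅ e, G.len e

/-- Lebesgue measure on the disjoint union of the edges (in edge coordinates). -/
def vol : Measure (Σ _ : E, ℝ) :=
  Measure.sum fun e => (volume.restrict (G.edge e)).map (Sigma.mk e)

open Classical in
/-- The function `u` in the coordinate of the edge `e` (extended by zero outside of the
interval `G.edge e`; the extension plays no role). -/
def onEdge (u : G.Space → ℝ) (e : E) (x : ℝ) : ℝ :=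
  if h : x ∈ G.edge e then u (G.point e ⟨x, h⟩) else 0

/-- The function `u` as a function on the disjoint union of the edges. -/
def coord (u : G.Space → ℝ) (q : Σ _ : E, ℝ) : ℝ := G.onEdge u q.1 q.2

/-- The derivative `u'` as a function on the disjoint union of the edges. -/
def coordDeriv (u : G.Space → ℝ) (q : Σ _ : E, ℝ) : ℝ := deriv (G.onEdge u q.1) q.2

/-- `u ∈ H¹(G)`: `u` is continuous on `G`, it is (locally) absolutely continuous on every closed
edge, and `u` and `u'` belong to `L²(G)`. -/
structure MemH1 (u : G.Space → ℝ) : Prop where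
  continuous : Continuous u
  absolutelyContinuous : ∀ e, ∀ a ∈ G.edge e, ∀ b ∈ G.edge e,
    AbsolutelyContinuousOnInterval (G.onEdge u e) a b
  memLp : MemLp (G.coord u) 2 G.vol
  memLp_deriv : MemLp (G.coordDeriv u) 2 G.vol

/-- The space `H¹_Z(G)` of functions of `H¹(G)` which vanish on `Z`. -/
def H1 (Z : Set V) : Set (G.Space → ℝ) := {u | G.MemH1 u ∧ ∀ v ∈ Z, u (G.vertex v) = 0}

/-- `‖u‖_{L^p(G)}^p` -/
def normPow (p : ℝ) (u : G.Space → ℝ) : ℝ := ∫ q, |G.coord u q| ^ p ∂G.vol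

/-- `‖u‖_{L²(G)}²` -/
def normSq (u : G.Space → ℝ) : ℝ := ∫ q, G.coord u q ^ 2 ∂G.vol

/-- `‖u'‖_{L²(G)}²` -/
def derivNormSq (u : G.Space → ℝ) : ℝ := ∫ q, G.coordDeriv u q ^ 2 ∂G.vol

/-- The bottom `ω_Z(G)` of the spectrum. -/
def omega (Z : Set V) : ℝ :=
  sInf ((fun v => G.derivNormSq v / G.normSq v) '' (G.H1 Z \ {0}))

/-- The action functional `J_λ`. -/
def action (p lam : ℝ) (u : G.Space → ℝ) : ℝ :=
  1 / 2 * G.derivNormSq u + lam / 2 * G.normSq u - 1 / p * G.normPow p u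

/-- The Nehari manifold `N_{λ,Z}(G)`. -/
def nehari (p lam : ℝ) (Z : Set V) : Set (G.Space → ℝ) :=
  {u | u ∈ G.H1 Z ∧ u ≠ 0 ∧ G.derivNormSq u + lam * G.normSq u = G.normPow p u}

/-- The nodal Nehari set `M_{λ,Z}(G)`. -/
def nodalNehari (p lam : ℝ) (Z : Set V) : Set (G.Space → ℝ) :=
  {u | u ∈ G.H1 Z ∧ (fun x => max (u x) 0) ∈ G.nehari p lam Z ∧
    (fun x => min (u x) 0) ∈ G.nehari p lam Z}

/-- `u` is a nodal ground state: a minimizer of the action on the nodal Nehari set. -/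
def IsNodalGroundState (p lam : ℝ) (Z : Set V) (u : G.Space → ℝ) : Prop :=
  u ∈ G.nodalNehari p lam Z ∧ IsMinOn (G.action p lam) (G.nodalNehari p lam Z) u

/-- The nodal domains of `u`: the connected components of `G \ u⁻¹(0)`. -/
abbrev NodalDomains (u : G.Space → ℝ) : Type _ := ConnectedComponents {x : G.Space // u x ≠ 0}

end MetricGraph

end

/-! Write `Q f = ‖f'‖² + λ‖f‖²`. Since `λ > -ω_Z`, `Q` is positive on nonzero functions of `H¹_Z`,
and on the nodal Nehari set the action equals `(1/2 - 1/p) (Q(u⁺) + Q(u⁻))`.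

If `{u > 0}` were disconnected, `u⁺` would split as `f + g` with nonzero pieces of disjoint
supports. Both `Q` and `‖·‖_p^p` are additive on such sums, so the Nehari identity of `u⁺` makes one
piece, say `f`, satisfy `Q f ≤ ‖f‖_p^p`. Some `t ≤ 1` then puts `t f` on the Nehari manifold. The
competitor `t f + u⁻` discards `g`, so its action is smaller by at least `(1/2 - 1/p) Q g > 0`,
contradicting minimality (`IsNodalGroundState.false_of_posPart_eq_add`). The symmetry `u ↦ -u`
handles `{u < 0}`.

The analytic input is that cutting `u⁺` along the splitting stays in `H¹_Z`
(`MemH1.of_eq_zero_or_eq`). No Sobolev embedding is needed: finiteness of the `L^p` norms comes from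
the Nehari identity itself. -/

open Filter Topology

/-! ### Cut-offs: absolute continuity and continuity -/

/-- If every increment of `g` is dominated by an increment of `f` over a smaller interval, then `g`
inherits the absolute continuity of `f`. -/
theorem AbsolutelyContinuousOnInterval.of_increments_le {f g : ℝ → ℝ} {a b : ℝ}
    (hf : AbsolutelyContinuousOnInterval f a b)
    (h : ∀ x ∈ uIcc a b, ∀ y ∈ uIcc a b, ∃ x' ∈ uIcc x y, ∃ y' ∈ uIcc x y,
      |g x - g y| ≤ |f x' - f y'|) :
    AbsolutelyContinuousOnInterval g a b := by
  rw [absolutelyContinuousOnInterval_iff] at hf ⊢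
  intro ε hε
  obtain ⟨δ, hδ, hE⟩ := hf ε hε
  refine ⟨δ, hδ, ?_⟩
  rintro ⟨n, I⟩ ⟨hI, hdisj⟩ hlen
  -- Each interval is replaced by a subinterval, which preserves disjointness and does not increase
  -- total length; indices outside the range get a dummy value.
  have h' : ∀ i, ∃ q : ℝ × ℝ, i ∈ Finset.range n → q.1 ∈ uIcc (I i).1 (I i).2 ∧
      q.2 ∈ uIcc (I i).1 (I i).2 ∧ |g (I i).1 - g (I i).2| ≤ |f q.1 - f q.2| := by
    intro i
    by_cases hi : i ∈ Finset.range n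
    · obtain ⟨x', hx', y', hy', hxy⟩ := h _ (hI i hi).1 _ (hI i hi).2
      exact ⟨(x', y'), fun _ => ⟨hx', hy', hxy⟩⟩
    · exact ⟨0, fun hi' => absurd hi' hi⟩
  choose J hJ using h'
  refine lt_of_le_of_lt (Finset.sum_le_sum fun i hi => (hJ i hi).2.2) (hE (n, J) ⟨?_, ?_⟩ ?_)
  · intro i hi
    have hsub := uIcc_subset_uIcc (hI i hi).1 (hI i hi).2
    exact ⟨hsub (hJ i hi).1, hsub (hJ i hi).2.1⟩
  · intro i hi j hj hij
    have key : ∀ k ∈ Finset.range n, uIoc (J k).1 (J k).2 ⊆ uIoc (I k).1 (I k).2 := by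
      intro k hk
      have h1 := (hJ k hk).1
      have h2 := (hJ k hk).2.1
      rw [uIcc, mem_Icc] at h1 h2
      exact Ioc_subset_Ioc (le_inf h1.1 h2.1) (sup_le h1.2 h2.2)
    exact (hdisj hi hj hij).mono (key i hi) (key j hj)
  · refine lt_of_le_of_lt (Finset.sum_le_sum fun i hi => ?_) hlen
    rw [dist_comm, Real.dist_eq, dist_comm, Real.dist_eq]
    exact abs_sub_le_of_uIcc_subset_uIcc (uIcc_subset_uIcc (hJ i hi).1 (hJ i hi).2.1)

/-- If `g` is continuous and coincides pointwise with `0` or with the continuous function `f`,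
then the increments of `g` are dominated by those of `f`. -/
theorem exists_increment_le {f g : ℝ → ℝ} {x y : ℝ} (hf : ContinuousOn f (uIcc x y))
    (hg : ContinuousOn g (uIcc x y)) (h : ∀ z ∈ uIcc x y, g z = 0 ∨ g z = f z) :
    ∃ x' ∈ uIcc x y, ∃ y' ∈ uIcc x y, |g x - g y| ≤ |f x' - f y'| := by
  have hz : (g x = f x ∧ g y = 0) ∨ (g x = 0 ∧ g y = f y) → ∃ z ∈ uIcc x y, f z = 0 := by
    intro hxy
    -- This function is `|f|` where `g = 0` and `-|f|` where `g = f`, so it changes sign between the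
    -- endpoints, and its zeros are zeros of `f`.
    have hc : ContinuousOn (fun z => |f z| - 2 * |g z|) (uIcc x y) :=
      hf.abs.sub (continuousOn_const.mul hg.abs)
    have h0 : (0 : ℝ) ∈ uIcc (|f x| - 2 * |g x|) (|f y| - 2 * |g y|) := by
      rw [mem_uIcc]
      rcases hxy with ⟨h1, h2⟩ | ⟨h1, h2⟩ <;> rw [h1, h2, abs_zero]
      · left; constructor <;> linarith [abs_nonneg (f x), abs_nonneg (f y)]
      · right; constructor <;> linarith [abs_nonneg (f x), abs_nonneg (f y)]
    obtain ⟨z, hz, hz0⟩ := intermediate_value_uIcc hc h0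
    refine ⟨z, hz, ?_⟩
    simp only at hz0
    rcases h z hz with h1 | h1 <;> rw [h1] at hz0
    · simpa using hz0
    · exact abs_eq_zero.1 (by linarith)
  rcases h x left_mem_uIcc with hx | hx <;> rcases h y right_mem_uIcc with hy | hy
  · exact ⟨x, left_mem_uIcc, x, left_mem_uIcc, by simp [hx, hy]⟩
  · obtain ⟨z, hz, hz0⟩ := hz (Or.inr ⟨hx, hy⟩)
    exact ⟨z, hz, y, right_mem_uIcc, by rw [hx, hy, hz0]⟩
  · obtain ⟨z, hz, hz0⟩ := hz (Or.inl ⟨hx, hy⟩)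
    exact ⟨x, left_mem_uIcc, z, hz, by rw [hx, hy, hz0]⟩
  · exact ⟨x, left_mem_uIcc, y, right_mem_uIcc, by rw [hx, hy]⟩

/-- Cutting off a continuous function along an open partition of its support keeps it
continuous. -/
theorem Continuous.indicator_of_isOpen_partition {X : Type*} [TopologicalSpace X] {f : X → ℝ}
    (hf : Continuous f) {D D' : Set X} (hD : IsOpen D) (hD' : IsOpen D')
    (hcov : ∀ x, f x ≠ 0 → x ∈ D ∪ D') (hdisj : ∀ x, x ∈ D → x ∈ D' → f x = 0) :
    Continuous (D.indicator f) := by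
  rw [continuous_iff_continuousAt]
  intro x
  by_cases hx : f x = 0
  · have h0 : D.indicator f x = 0 := by
      by_cases hxD : x ∈ D <;> simp [hxD, hx]
    rw [ContinuousAt, h0]
    have hf0 : Tendsto (fun y => ‖f y‖) (𝓝 x) (𝓝 0) := by
      simpa [hx] using (hf.tendsto x).norm
    exact squeeze_zero_norm (fun y => norm_indicator_le_norm_self f y) hf0
  · have hne : ∀ᶠ y in 𝓝 x, f y ≠ 0 := hf.continuousAt.eventually_ne hx
    rcases hcov x hx with h | h
    · refine hf.continuousAt.congr ?_
      filter_upwards [hD.mem_nhds h] with y hy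
      simp [hy]
    · refine (continuousAt_const (y := (0 : ℝ))).congr ?_
      filter_upwards [hD'.mem_nhds h, hne] with y hy hy0
      rw [indicator_of_notMem]
      exact fun hyD => hy0 (hdisj y hyD hy)

/-! ### Measurability on a disjoint union -/

theorem measurableEmbedding_sigmaMk {ι : Type*} {X : ι → Type*} [∀ i, MeasurableSpace (X i)]
    (i : ι) : MeasurableEmbedding (Sigma.mk i : X i → Σ i, X i) where
  injective := sigma_mk_injective
  measurable := by
    intro s hs
    exact (MeasurableSpace.measurableSet_iInf.1 hs) i
  measurableSet_image' := by
    intro s hs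
    refine MeasurableSpace.measurableSet_iInf.2 fun j => ?_
    change MeasurableSet (Sigma.mk j ⁻¹' (Sigma.mk i '' s))
    by_cases hij : i = j
    · subst hij
      rwa [preimage_image_eq _ sigma_mk_injective]
    · convert! MeasurableSet.empty
      ext x
      simp only [mem_preimage, mem_image, mem_empty_iff_false, iff_false]
      rintro ⟨y, -, hy⟩
      exact hij (congrArg Sigma.fst hy)

theorem measurable_of_measurable_comp_sigmaMk {ι Y : Type*} {X : ι → Type*}
    [∀ i, MeasurableSpace (X i)] [MeasurableSpace Y] {f : (Σ i, X i) → Y}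
    (hf : ∀ i, Measurable fun x => f ⟨i, x⟩) : Measurable f := fun _ hs =>
  MeasurableSpace.measurableSet_iInf.2 fun i => hf i hs

/-! ### Functions in edge coordinates -/

namespace MetricGraph

variable {V : Type*} {E : Type*} {G : MetricGraph V E} {Z : Set V} {p lam : ℝ}
  {f g u : G.Space → ℝ}

theorem ordConnected_edge (e : E) : OrdConnected (G.edge e) :=
  ⟨fun _ hx _ hy _ hz =>
    ⟨hx.1.trans hz.1, (ENNReal.ofReal_le_ofReal hz.2).trans hy.2⟩⟩

theorem measurableSet_edge (e : E) : MeasurableSet (G.edge e) :=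
  (ordConnected_edge e).measurableSet

theorem onEdge_of_mem {e : E} {x : ℝ} (hx : x ∈ G.edge e) :
    G.onEdge f e x = f (G.point e ⟨x, hx⟩) := dif_pos hx

theorem onEdge_of_notMem {e : E} {x : ℝ} (hx : x ∉ G.edge e) : G.onEdge f e x = 0 := dif_neg hx

theorem onEdge_add (e : E) : G.onEdge (f + g) e = G.onEdge f e + G.onEdge g e := by
  ext x
  by_cases hx : x ∈ G.edge e <;> simp [onEdge, hx]

theorem onEdge_smul (c : ℝ) (e : E) :
    G.onEdge (c • f) e = fun x => c * G.onEdge f e x := by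
  ext x
  by_cases hx : x ∈ G.edge e <;> simp [onEdge, hx]

theorem coord_add (q : Σ _ : E, ℝ) : G.coord (f + g) q = G.coord f q + G.coord g q := by
  simp [coord, onEdge_add]

theorem coord_smul (c : ℝ) (q : Σ _ : E, ℝ) : G.coord (c • f) q = c * G.coord f q := by
  simp [coord, onEdge_smul]

theorem coordDeriv_smul (c : ℝ) (q : Σ _ : E, ℝ) :
    G.coordDeriv (c • f) q = c * G.coordDeriv f q := by
  simp [coordDeriv, onEdge_smul]

theorem coord_eq_zero_or (h : ∀ x, g x = 0 ∨ g x = f x) (q : Σ _ : E, ℝ) :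
    G.coord g q = 0 ∨ G.coord g q = G.coord f q := by
  by_cases hx : q.2 ∈ G.edge q.1
  · simpa [coord, onEdge_of_mem hx] using h _
  · exact Or.inl (onEdge_of_notMem hx)

theorem coord_eq_zero_or_eq_zero (h : ∀ x, f x = 0 ∨ g x = 0) (q : Σ _ : E, ℝ) :
    G.coord f q = 0 ∨ G.coord g q = 0 := by
  by_cases hx : q.2 ∈ G.edge q.1
  · simpa [coord, onEdge_of_mem hx] using h _
  · exact Or.inl (onEdge_of_notMem hx)

theorem continuous_point (e : E) : Continuous (G.point e) := by
  let _ : TopologicalSpace V := ⊥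
  have h1 : Continuous (fun x : G.edge e => (Sum.inr ⟨e, x⟩ : V ⊕ (Σ e : E, G.edge e))) :=
    continuous_inr.comp continuous_sigmaMk
  have h2 : Continuous (Quot.mk G.Glue) := continuous_quot_mk
  exact h2.comp h1

theorem continuousOn_onEdge (hf : Continuous f) (e : E) :
    ContinuousOn (G.onEdge f e) (G.edge e) := by
  rw [continuousOn_iff_continuous_domRestrict]
  refine (hf.comp (continuous_point e)).congr fun x => ?_
  exact (onEdge_of_mem x.2).symm

theorem measurable_coord (hf : Continuous f) : Measurable (G.coord f) := by
  classical
  refine measurable_of_measurable_comp_sigmaMk fun e => ?_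
  have h : G.onEdge f e = (G.edge e).indicator (G.onEdge f e) := by
    ext x
    by_cases hx : x ∈ G.edge e
    · simp [hx]
    · simp [hx, onEdge_of_notMem]
  change Measurable (G.onEdge f e)
  rw [h, ← piecewise_eq_indicator]
  exact (continuousOn_onEdge hf e).measurable_piecewise continuousOn_const (measurableSet_edge e)

theorem ae_vol_iff [Countable E] {P : (Σ _ : E, ℝ) → Prop} :
    (∀ᵐ q ∂G.vol, P q) ↔ ∀ e, ∀ᵐ x, x ∈ G.edge e → P ⟨e, x⟩ := by
  rw [vol, Measure.ae_sum_iff]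
  refine forall_congr' fun e => ?_
  rw [(measurableEmbedding_sigmaMk (X := fun _ : E => ℝ) e).ae_map_iff,
    ae_restrict_iff' (measurableSet_edge e)]

/-- A function of constant sign. -/
def HasSign (f : G.Space → ℝ) : Prop := (∀ x, 0 ≤ f x) ∨ ∀ x, f x ≤ 0

/-- A zero of a function of constant sign is an extremum, even at the ends of an edge thanks to the
extension by zero. The derivative thus vanishes at every zero, not just almost every one. -/
theorem HasSign.coordDeriv_eq_zero (hf : G.HasSign f) {q : Σ _ : E, ℝ} (hq : G.coord f q = 0) :
    G.coordDeriv f q = 0 := by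
  have hq' : G.onEdge f q.1 q.2 = 0 := hq
  rcases hf with hf | hf
  · refine IsLocalMin.deriv_eq_zero (Eventually.of_forall fun x => ?_)
    change G.onEdge f q.1 q.2 ≤ G.onEdge f q.1 x
    by_cases hx : x ∈ G.edge q.1
    · rw [hq', onEdge_of_mem hx]; exact hf _
    · rw [hq', onEdge_of_notMem hx]
  · refine IsLocalMax.deriv_eq_zero (Eventually.of_forall fun x => ?_)
    change G.onEdge f q.1 x ≤ G.onEdge f q.1 q.2
    by_cases hx : x ∈ G.edge q.1
    · rw [hq', onEdge_of_mem hx]; exact hf _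
    · rw [hq', onEdge_of_notMem hx]

theorem coordDeriv_eq_of_coord_ne_zero (hg : Continuous g) (h : ∀ x, g x = 0 ∨ g x = f x)
    {q : Σ _ : E, ℝ} (hq : G.coord g q ≠ 0) : G.coordDeriv g q = G.coordDeriv f q := by
  obtain ⟨e, x⟩ := q
  have hx : x ∈ G.edge e := by
    by_contra hx
    exact hq (onEdge_of_notMem hx)
  refine EventuallyEq.deriv_eq ?_
  have h1 : ∀ᶠ y in 𝓝[G.edge e] x, G.onEdge g e y ≠ 0 :=
    (continuousOn_onEdge hg e x hx).eventually_ne hq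
  rw [eventually_nhdsWithin_iff] at h1
  filter_upwards [h1] with y hy
  by_cases hye : y ∈ G.edge e
  · exact (coord_eq_zero_or h ⟨e, y⟩).resolve_left (hy hye)
  · simp [onEdge_of_notMem hye]

/-! ### Stability of `H¹` and additivity of the norms -/

namespace MemH1

theorem ae_differentiableAt [Countable E] (hf : G.MemH1 f) :
    ∀ᵐ q ∂G.vol, DifferentiableAt ℝ (G.onEdge f q.1) q.2 := by
  rw [ae_vol_iff]
  intro e
  by_cases he : G.len e = ⊤
  · have hn : ∀ n : ℕ, ∀ᵐ x, x ∈ uIcc (0 : ℝ) n → DifferentiableAt ℝ (G.onEdge f e) x := fun n =>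
      (hf.absolutelyContinuous e 0 (G.zero_mem_edge e) n
        ⟨n.cast_nonneg, by simp [he]⟩).ae_differentiableAt
    filter_upwards [ae_all_iff.2 hn] with x hx hxe
    obtain ⟨n, hn⟩ := exists_nat_ge x
    exact hx n (by rw [uIcc_of_le n.cast_nonneg]; exact ⟨hxe.1, hn⟩)
  · have h := (hf.absolutelyContinuous e 0 (G.zero_mem_edge e) (G.len e).toReal
        ⟨ENNReal.toReal_nonneg, by rw [ENNReal.ofReal_toReal he]⟩).ae_differentiableAt
    filter_upwards [h] with x hx hxe
    refine hx ?_
    rw [uIcc_of_le ENNReal.toReal_nonneg]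
    exact ⟨hxe.1, (ENNReal.ofReal_le_iff_le_toReal he).1 hxe.2⟩

theorem coordDeriv_add_ae [Countable E] (hf : G.MemH1 f) (hg : G.MemH1 g) :
    G.coordDeriv (f + g) =ᵐ[G.vol] G.coordDeriv f + G.coordDeriv g := by
  filter_upwards [hf.ae_differentiableAt, hg.ae_differentiableAt] with q h1 h2
  rw [Pi.add_apply, coordDeriv, onEdge_add, deriv_add h1 h2, coordDeriv, coordDeriv]

theorem add [Countable E] (hf : G.MemH1 f) (hg : G.MemH1 g) : G.MemH1 (f + g) where
  continuous := hf.continuous.add hg.continuous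
  absolutelyContinuous e a ha b hb := by
    rw [onEdge_add]
    exact (hf.absolutelyContinuous e a ha b hb).add (hg.absolutelyContinuous e a ha b hb)
  memLp := by
    have h : G.coord (f + g) = G.coord f + G.coord g := funext coord_add
    rw [h]
    exact hf.memLp.add hg.memLp
  memLp_deriv :=
    (memLp_congr_ae (hf.coordDeriv_add_ae hg)).2 (hf.memLp_deriv.add hg.memLp_deriv)

theorem smul (hf : G.MemH1 f) (c : ℝ) : G.MemH1 (c • f) where
  continuous := hf.continuous.const_smul c
  absolutelyContinuous e a ha b hb := by
    rw [onEdge_smul]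
    exact (hf.absolutelyContinuous e a ha b hb).const_mul c
  memLp := by
    have h : G.coord (c • f) = fun q => c * G.coord f q := funext (coord_smul c)
    rw [h]
    exact hf.memLp.const_mul c
  memLp_deriv := by
    have h : G.coordDeriv (c • f) = fun q => c * G.coordDeriv f q := funext (coordDeriv_smul c)
    rw [h]
    exact hf.memLp_deriv.const_mul c

/-- A continuous function of constant sign which coincides pointwise with `0` or with `f ∈ H¹(G)`
belongs to `H¹(G)`. -/
theorem of_eq_zero_or_eq (hf : G.MemH1 f) (hg : Continuous g) (hsign : G.HasSign g)
    (h : ∀ x, g x = 0 ∨ g x = f x) : G.MemH1 g where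
  continuous := hg
  absolutelyContinuous e a ha b hb := by
    refine (hf.absolutelyContinuous e a ha b hb).of_increments_le fun x hx y hy => ?_
    have hsub : uIcc x y ⊆ G.edge e :=
      (uIcc_subset_uIcc hx hy).trans ((ordConnected_edge e).uIcc_subset ha hb)
    exact exists_increment_le ((continuousOn_onEdge hf.continuous e).mono hsub)
      ((continuousOn_onEdge hg e).mono hsub) fun z _ => coord_eq_zero_or h ⟨e, z⟩
  memLp := by
    refine hf.memLp.mono (measurable_coord hg).aestronglyMeasurable
      (Eventually.of_forall fun q => ?_)
    rcases coord_eq_zero_or h q with h | h <;> simp [h]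
  memLp_deriv := by
    have hS : MeasurableSet {q | G.coord g q ≠ 0} :=
      (measurable_coord hg) (measurableSet_singleton 0).compl
    -- Measurability and square integrability of `g'` are inherited from `f'` through this pointwise
    -- identity.
    have heq : G.coordDeriv g = {q | G.coord g q ≠ 0}.indicator (G.coordDeriv f) := by
      ext q
      by_cases hq : G.coord g q = 0
      · rw [indicator_of_notMem (by simpa using hq), hsign.coordDeriv_eq_zero hq]
      · rw [indicator_of_mem (by simpa using hq), coordDeriv_eq_of_coord_ne_zero hg h hq]
    rw [heq]
    exact hf.memLp_deriv.indicator hS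

theorem normSq_add (hf : G.MemH1 f) (hg : G.MemH1 g) (h : ∀ x, f x = 0 ∨ g x = 0) :
    G.normSq (f + g) = G.normSq f + G.normSq g := by
  rw [normSq, normSq, normSq, ← integral_add hf.memLp.integrable_sq hg.memLp.integrable_sq]
  congr 1
  ext q
  rw [coord_add]
  rcases coord_eq_zero_or_eq_zero h q with h | h <;> simp [h]

/-- At each point one of the functions vanishes, and its derivative with it, so there is no cross
term. -/
theorem derivNormSq_add [Countable E] (hf : G.MemH1 f) (hg : G.MemH1 g) (hfs : G.HasSign f)
    (hgs : G.HasSign g) (h : ∀ x, f x = 0 ∨ g x = 0) :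
    G.derivNormSq (f + g) = G.derivNormSq f + G.derivNormSq g := by
  rw [derivNormSq, derivNormSq, derivNormSq,
    ← integral_add hf.memLp_deriv.integrable_sq hg.memLp_deriv.integrable_sq]
  refine integral_congr_ae ?_
  filter_upwards [hf.coordDeriv_add_ae hg] with q hq
  rw [hq, Pi.add_apply]
  rcases coord_eq_zero_or_eq_zero h q with h | h
  · simp [hfs.coordDeriv_eq_zero h]
  · simp [hgs.coordDeriv_eq_zero h]

end MemH1

theorem normPow_add (hp : p ≠ 0) (hf : Integrable (fun q => |G.coord f q| ^ p) G.vol)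
    (hg : Integrable (fun q => |G.coord g q| ^ p) G.vol) (h : ∀ x, f x = 0 ∨ g x = 0) :
    G.normPow p (f + g) = G.normPow p f + G.normPow p g := by
  rw [normPow, normPow, normPow, ← integral_add hf hg]
  congr 1
  ext q
  rw [coord_add]
  rcases coord_eq_zero_or_eq_zero h q with h | h <;> simp [h, Real.zero_rpow hp]

theorem normSq_smul (c : ℝ) : G.normSq (c • f) = c ^ 2 * G.normSq f := by
  simp only [normSq, coord_smul, mul_pow, integral_const_mul]

theorem derivNormSq_smul (c : ℝ) : G.derivNormSq (c • f) = c ^ 2 * G.derivNormSq f := by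
  simp only [derivNormSq, coordDeriv_smul, mul_pow, integral_const_mul]

theorem normPow_smul (c : ℝ) : G.normPow p (c • f) = |c| ^ p * G.normPow p f := by
  simp only [normPow, coord_smul, abs_mul, Real.mul_rpow (abs_nonneg _) (abs_nonneg _),
    integral_const_mul]

/-! ### Positivity of the quadratic form -/

/-- A vertex without incident edges is a connected component. -/
theorem exists_eq_point [ConnectedSpace G.Space] [Nontrivial G.Space] (x : G.Space) :
    ∃ e y, x = G.point e y := by
  classical
  rcases Quot.exists_rep x with ⟨v | ⟨e, y⟩, rfl⟩
  swap
  · exact ⟨e, y, rfl⟩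
  by_contra hne
  push Not at hne
  have hsrc : ∀ e, G.src e ≠ v := fun e he =>
    hne e ⟨0, G.zero_mem_edge e⟩ (he ▸ (Quot.sound (Glue.src e)).symm)
  have htgt : ∀ (e : E) (y : G.edge e) (w : V), ENNReal.ofReal (y : ℝ) = G.len e →
      G.tgt e = some w → w ≠ v := fun e y w hy hw hwv =>
    hne e y (hwv ▸ (Quot.sound (Glue.tgt e y w hy hw)).symm)
  -- The indicator of `v` respects the gluing, so it descends to a continuous two-valued function,
  -- which connectedness forces to be constant.
  let φ : G.Pieces → Bool := Sum.elim (fun w => decide (w = v)) fun _ => false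
  have hφ : ∀ a b, G.Glue a b → φ a = φ b := by
    rintro a b (⟨e⟩ | ⟨e, y, w, hy, hw⟩)
    · simp [φ, hsrc e]
    · simp [φ, htgt e y w hy hw]
  have hφc : Continuous φ := by
    let _ : TopologicalSpace V := ⊥
    have : DiscreteTopology V := ⟨rfl⟩
    have : Continuous (Sum.elim (fun w => decide (w = v)) fun _ => false :
        V ⊕ (Σ e : E, G.edge e) → Bool) :=
      continuous_of_discreteTopology.sumElim continuous_const
    exact this
  let ψ : G.Space → Bool := Quot.lift φ hφ
  have hψ : Continuous ψ := continuous_quot_lift hφ hφc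
  obtain ⟨y, hy⟩ := exists_ne (G.vertex v)
  have hyv : ψ y = ψ (G.vertex v) := by
    exact PreconnectedSpace.constant (α := G.Space) inferInstance hψ (x := y) (y := G.vertex v)
  rcases Quot.exists_rep y with ⟨w | q, rfl⟩
  · have : decide (w = v) = decide (v = v) := hyv
    simp only [decide_eq_decide, iff_true] at this
    exact hy (by rw [this]; rfl)
  · have : false = decide (v = v) := hyv
    simp at this

theorem normSq_pos [ConnectedSpace G.Space] [Nontrivial G.Space] (hf : G.MemH1 f) (h0 : f ≠ 0) :
    0 < G.normSq f := by
  obtain ⟨x, hx⟩ := Function.ne_iff.1 h0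
  obtain ⟨e, ⟨y, hy⟩, rfl⟩ := exists_eq_point x
  have hfy : G.onEdge f e y ≠ 0 := by rw [onEdge_of_mem hy]; exact hx
  rw [normSq, integral_pos_iff_support_of_nonneg (fun q => sq_nonneg _) hf.memLp.integrable_sq]
  have hev := (continuousOn_onEdge hf.continuous e y hy).eventually_ne hfy
  obtain ⟨ε, hε, hball⟩ := Metric.mem_nhdsWithin_iff.1 hev
  have hS : MeasurableSet (Function.support fun q => G.coord f q ^ 2) :=
    ((measurable_coord hf.continuous).pow_const 2) (measurableSet_singleton 0).compl
  have hle : volume (Metric.ball y ε ∩ G.edge e) ≤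
      G.vol (Function.support fun q => G.coord f q ^ 2) := by
    rw [vol, Measure.sum_apply _ hS]
    refine le_trans ?_ (ENNReal.le_tsum e)
    rw [(measurableEmbedding_sigmaMk (X := fun _ : E => ℝ) e).map_apply,
      Measure.restrict_apply' (measurableSet_edge e)]
    refine measure_mono fun z hz => ⟨?_, hz.2⟩
    simpa using! hball hz
  refine lt_of_lt_of_le ?_ hle
  -- A second point of the edge shows on which side of `y` a nondegenerate interval fits, since `y`
  -- may be an endpoint.
  obtain ⟨z, hz, hzy⟩ : ∃ z ∈ G.edge e, z ≠ y := by
    by_cases hy0 : y = 0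
    · obtain ⟨r, hr0, hr⟩ := ENNReal.lt_iff_exists_nnreal_btwn.1 (G.len_pos e)
      refine ⟨r, ⟨r.2, by simpa using hr.le⟩, ?_⟩
      rw [hy0]
      exact_mod_cast hr0.ne'
    · exact ⟨0, G.zero_mem_edge e, fun h => hy0 h.symm⟩
  have hsub : uIcc z y ⊆ G.edge e := (ordConnected_edge e).uIcc_subset hz hy
  rcases lt_or_gt_of_ne hzy with h | h
  · refine lt_of_lt_of_le ?_ (measure_mono (s := Ioo (max z (y - ε)) y) fun w hw => ?_)
    · simp [h, hε]
    · obtain ⟨h1, h2⟩ := hw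
      rw [max_lt_iff] at h1
      refine ⟨?_, hsub (by rw [uIcc_of_le h.le]; exact ⟨h1.1.le, h2.le⟩)⟩
      rw [Metric.mem_ball, Real.dist_eq, abs_lt]
      constructor <;> linarith
  · refine lt_of_lt_of_le ?_ (measure_mono (s := Ioo y (min z (y + ε))) fun w hw => ?_)
    · simp [h, hε]
    · obtain ⟨h1, h2⟩ := hw
      rw [lt_min_iff] at h2
      refine ⟨?_, hsub (by rw [uIcc_of_ge h.le]; exact ⟨h1.le, h2.1.le⟩)⟩
      rw [Metric.mem_ball, Real.dist_eq, abs_lt]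
      constructor <;> linarith

/-- For `λ > -ω_Z(G)` the quadratic part of the action is positive. -/
theorem quadratic_pos [ConnectedSpace G.Space] [Nontrivial G.Space] (hlam : -G.omega Z < lam)
    (hf : f ∈ G.H1 Z) (h0 : f ≠ 0) : 0 < G.derivNormSq f + lam * G.normSq f := by
  have hpos := normSq_pos hf.1 h0
  have hle : G.omega Z ≤ G.derivNormSq f / G.normSq f := by
    refine csInf_le ⟨0, ?_⟩ (mem_image_of_mem _ ⟨hf, h0⟩)
    rintro _ ⟨v, -, rfl⟩
    exact div_nonneg (integral_nonneg fun _ => sq_nonneg _) (integral_nonneg fun _ => sq_nonneg _)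
  rw [le_div_iff₀ hpos] at hle
  nlinarith

/-! ### The Nehari manifold -/

theorem H1_smul (hf : f ∈ G.H1 Z) (c : ℝ) : c • f ∈ G.H1 Z :=
  ⟨hf.1.smul c, fun v hv => by simp [hf.2 v hv]⟩

theorem H1_add [Countable E] (hf : f ∈ G.H1 Z) (hg : g ∈ G.H1 Z) : f + g ∈ G.H1 Z :=
  ⟨hf.1.add hg.1, fun v hv => by simp [hf.2 v hv, hg.2 v hv]⟩

theorem H1_of_eq_zero_or_eq (hf : f ∈ G.H1 Z) (hg : Continuous g) (hsign : G.HasSign g)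
    (h : ∀ x, g x = 0 ∨ g x = f x) : g ∈ G.H1 Z :=
  ⟨hf.1.of_eq_zero_or_eq hg hsign h, fun v hv => by
    rcases h (G.vertex v) with h | h
    · exact h
    · rw [h, hf.2 v hv]⟩

theorem posPart_add_negPart (u : G.Space → ℝ) :
    ((fun x => max (u x) 0) + fun x => min (u x) 0 : G.Space → ℝ) = u := by
  ext x
  simp [max_add_min]

theorem posPart_eq_zero_or_negPart_eq_zero (u : G.Space → ℝ) (x : G.Space) :
    max (u x) 0 = 0 ∨ min (u x) 0 = 0 := by
  rcases le_total (u x) 0 with h | h <;> simp [h]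

theorem quadratic_add [Countable E] (hf : f ∈ G.H1 Z) (hg : g ∈ G.H1 Z) (hfs : G.HasSign f)
    (hgs : G.HasSign g) (h : ∀ x, f x = 0 ∨ g x = 0) :
    G.derivNormSq (f + g) + lam * G.normSq (f + g) =
      (G.derivNormSq f + lam * G.normSq f) + (G.derivNormSq g + lam * G.normSq g) := by
  rw [hf.1.derivNormSq_add hg.1 hfs hgs h, hf.1.normSq_add hg.1 h]
  ring

/-- On the Nehari manifold the `L^p` norm is positive, hence finite. -/
theorem integrable_of_mem_nehari [ConnectedSpace G.Space] [Nontrivial G.Space]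
    (hlam : -G.omega Z < lam) (hf : f ∈ G.nehari p lam Z) :
    Integrable (fun q => |G.coord f q| ^ p) G.vol := by
  by_contra h
  have h1 := quadratic_pos hlam hf.1 hf.2.1
  -- The integral of a non-integrable function is `0` by convention, which would give `Q f = 0`.
  rw [hf.2.2, normPow, integral_undef h] at h1
  exact lt_irrefl _ h1

/-- The action of a sign-changing function both of whose parts satisfy the Nehari identity. -/
theorem action_add_eq [Countable E] [ConnectedSpace G.Space] [Nontrivial G.Space] (hp : 2 < p)
    (hlam : -G.omega Z < lam) (hf : f ∈ G.nehari p lam Z) (hg : g ∈ G.nehari p lam Z)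
    (hfs : G.HasSign f) (hgs : G.HasSign g) (h : ∀ x, f x = 0 ∨ g x = 0) :
    G.action p lam (f + g) = (1 / 2 - 1 / p) *
      ((G.derivNormSq f + lam * G.normSq f) + (G.derivNormSq g + lam * G.normSq g)) := by
  have hb := normPow_add (by linarith) (integrable_of_mem_nehari hlam hf)
    (integrable_of_mem_nehari hlam hg) h
  have ha := quadratic_add (lam := lam) hf.1 hg.1 hfs hgs h
  rw [← hf.2.2, ← hg.2.2] at hb
  rw [action, hb]
  linear_combination (1 / 2 : ℝ) * ha

/-- A function with `‖f'‖² + λ‖f‖² ≤ ‖f‖_p^p` is pulled back to the Nehari manifold by a factor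
which is at most one. -/
theorem exists_smul_mem_nehari (hp : 2 < p) (hf : f ∈ G.H1 Z) (h0 : f ≠ 0)
    (ha : 0 < G.derivNormSq f + lam * G.normSq f)
    (hab : G.derivNormSq f + lam * G.normSq f ≤ G.normPow p f) :
    ∃ t : ℝ, 0 < t ∧ t ≤ 1 ∧ t • f ∈ G.nehari p lam Z := by
  set a := G.derivNormSq f + lam * G.normSq f with ha_def
  have hb : 0 < G.normPow p f := ha.trans_le hab
  have hr : 0 < a / G.normPow p f := div_pos ha hb
  have ht : 0 < (a / G.normPow p f) ^ (1 / (p - 2)) := Real.rpow_pos_of_pos hr _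
  -- This is the positive solution of `t² Q f = t^p ‖f‖_p^p`.
  refine ⟨(a / G.normPow p f) ^ (1 / (p - 2)), ht, ?_, H1_smul hf _, smul_ne_zero ht.ne' h0, ?_⟩
  · exact Real.rpow_le_one hr.le ((div_le_one hb).2 hab)
      (div_nonneg zero_le_one (by linarith))
  · rw [derivNormSq_smul, normSq_smul, normPow_smul, abs_of_pos ht]
    set t := (a / G.normPow p f) ^ (1 / (p - 2)) with ht_def
    have h1 : t ^ (p - 2) = a / G.normPow p f := by
      rw [ht_def, ← Real.rpow_mul hr.le, one_div_mul_cancel (by linarith), Real.rpow_one]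
    have h2 : t ^ p = t ^ 2 * (a / G.normPow p f) := by
      rw [← h1, ← Real.rpow_natCast t 2, ← Real.rpow_add ht]
      congr 1
      push_cast
      ring
    rw [h2, mul_assoc, div_mul_cancel₀ _ hb.ne', ha_def]
    ring

/-! ### Connectedness of the positive set -/

/-- The positive part of a nodal ground state does not split into two disjointly supported pieces
of which one has `‖f'‖² + λ‖f‖² ≤ ‖f‖_p^p`. -/
theorem IsNodalGroundState.false_of_posPart_eq_add [Countable E] [ConnectedSpace G.Space]
    [Nontrivial G.Space] (hp : 2 < p) (hlam : -G.omega Z < lam)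
    (hu : G.IsNodalGroundState p lam Z u) (hf : f ∈ G.H1 Z) (hg : g ∈ G.H1 Z)
    (hf0 : f ≠ 0) (hg0 : g ≠ 0) (hfs : ∀ x, 0 ≤ f x) (hgs : ∀ x, 0 ≤ g x)
    (hfg : ∀ x, f x = 0 ∨ g x = 0) (hsum : f + g = fun x => max (u x) 0)
    (hab : G.derivNormSq f + lam * G.normSq f ≤ G.normPow p f) : False := by
  obtain ⟨⟨-, hP, hN⟩, hmin⟩ := hu
  have ha := quadratic_pos hlam hf hf0
  have hb := quadratic_pos hlam hg hg0
  obtain ⟨t, ht0, ht1, ht⟩ := exists_smul_mem_nehari hp hf hf0 ha hab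
  have hNs : G.HasSign fun x => min (u x) 0 := Or.inr fun x => min_le_right _ _
  have htf : ∀ x, 0 ≤ (t • f) x := fun x => mul_nonneg ht0.le (hfs x)
  have hfN : ∀ x, (t • f) x = 0 ∨ min (u x) 0 = 0 := by
    intro x
    rcases posPart_eq_zero_or_negPart_eq_zero u x with h | h
    · left
      have h1 : f x + g x = max (u x) 0 := congrFun hsum x
      have h2 : f x = 0 := by linarith [hfs x, hgs x]
      simp [h2]
    · exact Or.inr h
  set v : G.Space → ℝ := t • f + fun x => min (u x) 0 with hv
  have hvP : (fun x => max (v x) 0) = t • f := by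
    ext x
    have hvx : v x = (t • f) x + min (u x) 0 := rfl
    rcases hfN x with h | h
    · rw [hvx, h, zero_add, max_eq_right (min_le_right _ _)]
    · rw [hvx, h, add_zero, max_eq_left (htf x)]
  have hvN : (fun x => min (v x) 0) = fun x => min (u x) 0 := by
    ext x
    have hvx : v x = (t • f) x + min (u x) 0 := rfl
    rcases hfN x with h | h
    · rw [hvx, h, zero_add, min_eq_left (min_le_right _ _)]
    · rw [hvx, h, add_zero, min_eq_right (htf x)]
  have hvM : v ∈ G.nodalNehari p lam Z :=
    ⟨H1_add ht.1 hN.1, by rw [hvP]; exact ht, by rw [hvN]; exact hN⟩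
  have hle : G.action p lam u ≤ G.action p lam v := hmin hvM
  rw [hv, action_add_eq hp hlam ht hN (Or.inl htf) hNs hfN] at hle
  have hu_eq := action_add_eq hp hlam hP hN (Or.inl fun x => le_max_right _ _) hNs
    (posPart_eq_zero_or_negPart_eq_zero u)
  rw [posPart_add_negPart] at hu_eq
  rw [hu_eq, ← hsum, quadratic_add hf hg (Or.inl hfs) (Or.inl hgs) hfg, derivNormSq_smul,
    normSq_smul] at hle
  have hp' : 0 < 1 / 2 - 1 / p := sub_pos.2 (one_div_lt_one_div_of_lt two_pos hp)
  have hle' := le_of_mul_le_mul_left hle hp'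
  have ht2 : t ^ 2 ≤ 1 := pow_le_one₀ ht0.le ht1
  -- `hle'` would give `Q f + Q g ≤ t² Q f`, against `t² ≤ 1` and `Q f, Q g > 0`.
  nlinarith

theorem IsNodalGroundState.isPreconnected_pos [Countable E] [ConnectedSpace G.Space]
    [Nontrivial G.Space] (hp : 2 < p) (hlam : -G.omega Z < lam)
    (hu : G.IsNodalGroundState p lam Z u) : IsPreconnected {x | 0 < u x} := by
  intro D D' hD hD' hcov hne hne'
  by_contra hdisj
  rw [not_nonempty_iff_eq_empty] at hdisj
  have hP : (fun x => max (u x) 0) ∈ G.nehari p lam Z := hu.1.2.1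
  set P : G.Space → ℝ := fun x => max (u x) 0 with hP_def
  have hP0 : ∀ x, P x ≠ 0 → 0 < u x := fun x hx => by
    by_contra h
    exact hx (max_eq_right (not_lt.1 h))
  have hcov' : ∀ x, P x ≠ 0 → x ∈ D ∪ D' := fun x hx => hcov (hP0 x hx)
  -- The open sets may still overlap, but only where `u ≤ 0`.
  have hdisj' : ∀ x, x ∈ D → x ∈ D' → P x = 0 := fun x h1 h2 => by
    by_contra h
    exact (eq_empty_iff_forall_notMem.1 hdisj) x ⟨hP0 x h, h1, h2⟩
  have hPnn : ∀ x, 0 ≤ P x := fun x => le_max_right _ _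
  have hc := hP.1.1.continuous
  have hmem : ∀ S : Set G.Space, Continuous (S.indicator P) → S.indicator P ∈ G.H1 Z :=
    fun S hS => H1_of_eq_zero_or_eq hP.1 hS (Or.inl fun x => indicator_nonneg (fun y _ => hPnn y) x)
      fun x => indicator_eq_zero_or_self S P x
  have h1 := hmem D (hc.indicator_of_isOpen_partition hD hD' hcov' hdisj')
  have h2 := hmem D' (hc.indicator_of_isOpen_partition hD' hD
    (fun x hx => union_comm D D' ▸ hcov' x hx) fun x h h' => hdisj' x h' h)
  have hn : ∀ S : Set G.Space, ({x | 0 < u x} ∩ S).Nonempty → S.indicator P ≠ 0 := by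
    rintro S ⟨x, hx, hxS⟩ h
    have h' := congrFun h x
    rw [indicator_of_mem hxS, hP_def] at h'
    exact absurd (h' : max (u x) 0 = 0) (lt_max_of_lt_left hx).ne'
  have hnn : ∀ S : Set G.Space, ∀ x, 0 ≤ S.indicator P x :=
    fun S x => indicator_nonneg (fun y _ => hPnn y) x
  have hprod : ∀ x, D.indicator P x = 0 ∨ D'.indicator P x = 0 := fun x => by
    by_cases hx : x ∈ D
    · by_cases hx' : x ∈ D'
      · simp [hx, hdisj' x hx hx']
      · simp [hx']
    · simp [hx]
  have hsum : D.indicator P + D'.indicator P = P := by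
    ext x
    rw [Pi.add_apply]
    by_cases h0 : P x = 0
    · have h (S : Set G.Space) : S.indicator P x = 0 := by
        rcases indicator_eq_zero_or_self S P x with h | h
        · exact h
        · rw [h, h0]
      rw [h, h, h0, add_zero]
    · by_cases hx : x ∈ D
      · have hx' : x ∉ D' := fun hx' => h0 (hdisj' x hx hx')
        simp [hx, hx']
      · have hx' : x ∈ D' := (hcov' x h0).resolve_left hx
        simp [hx, hx']
  have hint : ∀ S : Set G.Space, Continuous (S.indicator P) →
      Integrable (fun q => |G.coord (S.indicator P) q| ^ p) G.vol := fun S hS => by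
    refine (integrable_of_mem_nehari hlam hP).mono
      ((measurable_coord hS).abs.pow_const p).aestronglyMeasurable
      (Eventually.of_forall fun q => ?_)
    rcases coord_eq_zero_or (fun x => indicator_eq_zero_or_self S P x) q with h | h
    · rw [h, abs_zero, Real.zero_rpow (by linarith), norm_zero]
      exact norm_nonneg _
    · rw [h]
  have hb := normPow_add (by linarith) (hint D h1.1.continuous) (hint D' h2.1.continuous) hprod
  have ha := quadratic_add (lam := lam) h1 h2 (Or.inl (hnn D)) (Or.inl (hnn D')) hprod
  rw [hsum] at ha hb
  have hN := hP.2.2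
  -- The two defects `Q - ‖·‖_p^p` add up to zero, so one of them is nonpositive.
  rcases le_or_gt (G.derivNormSq (D.indicator P) + lam * G.normSq (D.indicator P))
    (G.normPow p (D.indicator P)) with h | h
  · exact hu.false_of_posPart_eq_add hp hlam h1 h2 (hn D hne) (hn D' hne') (hnn D) (hnn D') hprod
      hsum h
  · refine hu.false_of_posPart_eq_add hp hlam h2 h1 (hn D' hne') (hn D hne) (hnn D') (hnn D)
      (fun x => (hprod x).symm) ((add_comm _ _).trans hsum) ?_
    linarith

/-! ### Symmetry under change of sign -/

theorem derivNormSq_neg : G.derivNormSq (-f) = G.derivNormSq f := by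
  simpa using derivNormSq_smul (f := f) (-1)

theorem normSq_neg : G.normSq (-f) = G.normSq f := by
  simpa using normSq_smul (f := f) (-1)

theorem normPow_neg : G.normPow p (-f) = G.normPow p f := by
  simpa using normPow_smul (f := f) (p := p) (-1)

theorem action_neg : G.action p lam (-f) = G.action p lam f := by
  rw [action, derivNormSq_neg, normSq_neg, normPow_neg, action]

theorem H1_neg (hf : f ∈ G.H1 Z) : -f ∈ G.H1 Z := by
  simpa using H1_smul hf (-1)

theorem nehari_neg (hf : f ∈ G.nehari p lam Z) : -f ∈ G.nehari p lam Z :=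
  ⟨H1_neg hf.1, neg_ne_zero.2 hf.2.1, by
    rw [derivNormSq_neg, normSq_neg, normPow_neg]; exact hf.2.2⟩

theorem nodalNehari_neg (hu : u ∈ G.nodalNehari p lam Z) : -u ∈ G.nodalNehari p lam Z := by
  refine ⟨H1_neg hu.1, ?_, ?_⟩
  · convert! nehari_neg hu.2.2 using 1
    ext x
    simp [← max_neg_neg]
  · convert! nehari_neg hu.2.1 using 1
    ext x
    simp [← min_neg_neg]

theorem IsNodalGroundState.neg (hu : G.IsNodalGroundState p lam Z u) :
    G.IsNodalGroundState p lam Z (-u) :=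
  ⟨nodalNehari_neg hu.1, fun v hv => by
    have h : G.action p lam u ≤ G.action p lam (-v) := hu.2 (nodalNehari_neg hv)
    change G.action p lam (-u) ≤ G.action p lam v
    rwa [action_neg, ← action_neg (f := v)]⟩

end MetricGraph

/-! ### Counting the nodal domains -/

/-- If `{u > 0}` and `{u < 0}` are connected and nonempty, then `{u ≠ 0}` has exactly two connected
components. -/
theorem card_connectedComponents_ne_zero_eq_two {X : Type*} [TopologicalSpace X] {u : X → ℝ}
    (hu : Continuous u) (hpos : IsPreconnected {x | 0 < u x}) (hneg : IsPreconnected {x | u x < 0})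
    {a b : X} (ha : 0 < u a) (hb : u b < 0) :
    Nat.card (ConnectedComponents {x // u x ≠ 0}) = 2 := by
  have hlift : ∀ S : Set X, IsPreconnected S → (∀ x ∈ S, u x ≠ 0) →
      IsPreconnected ((↑) ⁻¹' S : Set {x // u x ≠ 0}) := by
    intro S hS h
    refine Topology.IsInducing.subtypeVal.isPreconnected_image.1 ?_
    convert! hS using 1
    ext x
    exact ⟨fun ⟨y, hy, hyx⟩ => hyx ▸ hy, fun hx => ⟨⟨x, h x hx⟩, hx, rfl⟩⟩
  have hposX := hlift _ hpos fun x hx => ne_of_gt hx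
  have hnegX := hlift _ hneg fun x hx => ne_of_lt hx
  rw [Nat.card_eq_two_iff]
  refine ⟨((⟨a, ha.ne'⟩ : {x // u x ≠ 0}) : ConnectedComponents _),
    ((⟨b, hb.ne⟩ : {x // u x ≠ 0}) : ConnectedComponents _), ?_, ?_⟩
  · rw [Ne, ConnectedComponents.coe_eq_coe']
    intro h
    -- Within `{u ≠ 0}` the conditions `u < 0` and `u ≤ 0` agree, so the negative set is clopen and
    -- contains the whole component of `b`.
    have hclopen : IsClopen ((↑) ⁻¹' {x | u x < 0} : Set {x // u x ≠ 0}) := by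
      refine ⟨?_, (isOpen_lt hu continuous_const).preimage continuous_subtype_val⟩
      convert! (isClosed_le hu continuous_const : IsClosed {x | u x ≤ 0}).preimage
        (continuous_subtype_val (p := fun x => u x ≠ 0)) using 1
      ext x
      exact ⟨fun hx => le_of_lt (show u x < 0 from hx), fun hx => lt_of_le_of_ne hx x.2⟩
    exact lt_asymm ha (hclopen.connectedComponent_subset (x := ⟨b, hb.ne⟩) hb h)
  · refine eq_univ_of_forall fun c => ?_
    obtain ⟨⟨x, hx⟩, rfl⟩ := ConnectedComponents.surjective_coe c
    rcases lt_or_gt_of_ne hx with h | h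
    · exact Or.inr (ConnectedComponents.coe_eq_coe'.2
        (hnegX.subset_connectedComponent (x := ⟨b, hb.ne⟩) hb h))
    · exact Or.inl (ConnectedComponents.coe_eq_coe'.2
        (hposX.subset_connectedComponent (x := ⟨a, ha.ne'⟩) ha h))

theorem mainTheorem12 {V : Type*} {E : Type*} (G : MetricGraph V E) (hG : G.IsAdmissible)
    (p : ℝ) (hp : 2 < p) (Z : Set V) (hZ : ∀ v ∈ Z, G.degree v = 1)
    (lam : ℝ) (hlam : -G.omega Z < lam)
    (u : G.Space → ℝ) (hu : G.IsNodalGroundState p lam Z u) :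
    Nat.card (G.NodalDomains u) = 2 := by
  have := hG.connected
  have := hG.countable
  obtain ⟨a, ha⟩ : ∃ a, 0 < u a := by
    by_contra! h
    exact hu.1.2.1.2.1 (funext fun x => max_eq_right (h x))
  obtain ⟨b, hb⟩ : ∃ b, u b < 0 := by
    by_contra! h
    exact hu.1.2.2.2.1 (funext fun x => min_eq_right (h x))
  -- This excludes a graph reduced to one isolated vertex.
  have : Nontrivial G.Space := ⟨a, b, fun h => by rw [h] at ha; exact lt_asymm ha hb⟩
  refine card_connectedComponents_ne_zero_eq_two hu.1.1.1.continuous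
    (hu.isPreconnected_pos hp hlam) ?_ ha hb
  simpa using hu.neg.isPreconnected_pos hp hlam
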